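/- **Problem.** Let $H\in\mathbb R^{n\times n}$ be symmetric, $c,q\in\mathbb R^n$, $b\in\mathbb R$, $l\in(\mathbb R\cup\{-\infty\})^n$, $u\in(\mathbb R\cup\{+\infty\})^n$ with $l_i<u_i$ for all $i$, and consider $$\min f(x):=\tfrac12x^THx-c^Tx\quad\text{s.t. } x\in\Omega:=\{x\in\mathbb R^n:\ q^Tx=b,\ l\le x\le u\}.$$ Assume that the problem is strictly convex, i.e. $f$ is strictly convex on $\Omega$ (for instance, $H$ is positive definite, or positive definite on $\{q\}^\perp$), and that $x^*\in\Omega$ is its optimal solution. **Notation.** $P_C$ is the orthogonal projection onto a closed convex set $C$; $\|\cdot\|$ is the Euclidean norm. For $x\in\Omega$ put $\mathcal A_l(x)=\{i:x_i=l_i\}$, $\mathcal A_u(x)=\{i:x_i=u_i\}$, $\mathcal A(x)=\mathcal A_l(x)\cup\mathcal A_u(x)$, $\mathcal F(x)=\{1,\dots,n\}\setminus\mathcal A(x)$. Inclusions and equalities between active sets are understood separately for the lower and for the upper parts. Let $\Omega(x)=\{v: q^Tv=b,\ v_i=x_i\ \forall i\in\mathcal A(x)\}$, $T_\Omega(x)=\{v: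 q^Tv=0,\ v_i\ge0\ \forall i\in\mathcal A_l(x),\ v_i\le0\ \forall i\in\mathcal A_u(x)\}$ and $\nabla_\Omega f(x)=\operatorname{argmin}\{\|v+\nabla f(x)\|: v\in T_\Omega(x)\}$. With $\mathcal F=\mathcal F(x)$ let $\rho(x)=0$ if $q_{\mathcal F}=0$ and $\rho(x)=q_{\mathcal F}^T\nabla f_{\mathcal F}(x)/q_{\mathcal F}^Tq_{\mathcal F}$ otherwise, and $h(x)=\nabla f(x)-\rho(x)q$. The free gradient is $\varphi_i(x)=h_i(x)$ for $i\in\mathcal F(x)$, $\varphi_i(x)=0$ for $i\in\mathcal A(x)$; the chopped gradient is $\beta(x)=-\nabla_\Omega f(x)-\varphi(x)$. Superscripts $k$ denote values at $x^k$. **The P2GP method.** Fix $tol\ge0$, $\eta\in(0,1)$, $\Gamma>0$, $\gamma_1,\gamma_2,\gamma_3>0$, $\mu_1,\mu_2\in(0,1)$ and $x^0\in\Omega$. The method stops and returns $x^k$ as soon as $\|\varphi^k+\beta^k\|\le tol$ (tested at $x^0$ and after every step). Starting with an identification phase, it alternates the following two phases. *Identification phase*, started at iteration $m$. If $(\nabla_\Omega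 f^k)^TH\,\nabla_\Omega f^k\le0$ and there are arbitrarily large $\alpha>0$ with $x^k+\alpha\nabla_\Omega f^k\in\Omega$, stop and report unboundedness. Otherwise set $x^{k+1}=x^k(\alpha^k)$, where $x^k(\alpha)=P_\Omega(x^k-\alpha\nabla f^k)$ and $\alpha^k$ satisfies $f^{k+1}\le f^k+\mu_1(\nabla f^k)^T(x^{k+1}-x^k)$, $\alpha^k\le\gamma_1$, and either $\alpha^k\ge\gamma_2$ or $\alpha^k\ge\gamma_3\bar\alpha^k>0$ for some $\bar\alpha^k$ with $f(x^k(\bar\alpha^k))>f^k+\mu_2(\nabla f^k)^T(x^k(\bar\alpha^k)-x^k)$ (a GP iteration; $k\in K_{GP}$). The phase goes on with iteration $k+1$ if $\mathcal A^{k+1}\ne\mathcal A^k$ and $f^k-f^{k+1}>\eta\max_{m\le j<k}(f^j-f^{j+1})$ (the latter being void for $k=m$); otherwise a minimization phase starts. *Minimization phase.* Take a direction $d^k$ with $q^Td^k=0$ and $d^k_i=0$ for $i\in\mathcal A^k$ (an approximate solution, of unspecified accuracy, of $\min f(x^k+d)$ over these $d$). If $(d^k)^THd^k\le0$, let $\alpha^k$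 be the largest $\alpha>0$ with $x^k+\alpha d^k\in\Omega$: if there is none because such $\alpha$ are unbounded, stop and report unboundedness; otherwise set $x^{k+1}=x^k+\alpha^kd^k$ and start a new identification phase. If $(d^k)^THd^k>0$, set $x^{k+1}=P_{\Omega\cap\Omega(x^k)}(x^k+\alpha^kd^k)$ with $\alpha^k>0$ such that $f^{k+1}<f^k$; the phase goes on if $\|\beta^{k+1}\|_\infty\le\Gamma\|\varphi^{k+1}\|$, and otherwise a new identification phase starts. **Statement.** Let $\{x^k\}$ be a sequence generated by the P2GP method. Assume that the set $K_{GP}$ of GP iterations is infinite, or that $tol=0$ and the method stops with $\|\varphi^K+\beta^K\|\le tol$ at some iteration $K$, in which case put $x^k=x^K$ for $k>K$. Then the whole sequence $\{x^k\}$ converges to $x^*$, and $\mathcal A(x^k)\subseteq\mathcal A(x^*)$ for all sufficiently large $k$. Moreover, for any Lagrange multipliers $\rho^*\in\mathbb R$, $\lambda^*\in\mathbb R^n$ at $x^*$, that is, $\nabla f(x^*)=\sum_{i\in\mathcal A(x^*)}\lambda_i^*e_i+\rho^*q$ with $\lambda_i^*\ge0$ for $i\in\mathcal A_l(x^*)$,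 $\lambda_i^*\le0$ for $i\in\mathcal A_u(x^*)$ and $\lambda_i^*=0$ for $i\notin\mathcal A(x^*)$, the set $\mathcal A_N^*=\{i\in\mathcal A(x^*):\lambda_i^*\ne0\}$ satisfies $$\mathcal A_N^*\subseteq\mathcal A(x^k)\subseteq\mathcal A(x^*)\qquad\text{for all sufficiently large }k.$$ -/

import Mathlib

/-- A nearest point of `K` to `y` in the norm of `E` (and `0` if there is none). For a nonempty
closed convex subset of a Euclidean space this is the orthogonal projection onto `K`; see
`nearestPt_spec` and `nearestPt_unique`. -/
noncomputable def nearestPt {E : Type*} [NormedAddCommGroup E] (K : Set E) (y : E) : E :=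
  open Classical in
  if h : ∃ p ∈ K, ∀ z ∈ K, ‖y - p‖ ≤ ‖y - z‖ then h.choose else 0

theorem nearestPt_spec {E : Type*} [NormedAddCommGroup E] [ProperSpace E] {K : Set E}
    (hne : K.Nonempty) (hcl : IsClosed K) (y : E) :
    nearestPt K y ∈ K ∧ ∀ z ∈ K, ‖y - nearestPt K y‖ ≤ ‖y - z‖ := by
  have h : ∃ p ∈ K, ∀ z ∈ K, ‖y - p‖ ≤ ‖y - z‖ := by
    obtain ⟨p, hp, hd⟩ := hcl.exists_infDist_eq_dist hne y
    refine ⟨p, hp, fun z hz => ?_⟩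
    rw [← dist_eq_norm, ← dist_eq_norm, ← hd]
    exact Metric.infDist_le_dist_of_mem hz
  have h2 : nearestPt K y = h.choose := by
    unfold nearestPt
    exact dif_pos h
  rw [h2]
  exact h.choose_spec

theorem nearestPt_unique {E : Type*} [NormedAddCommGroup E] [InnerProductSpace ℝ E]
    {K : Set E} (hK : Convex ℝ K) (y p : E) (hp : p ∈ K)
    (hmin : ∀ z ∈ K, ‖y - p‖ ≤ ‖y - z‖) : nearestPt K y = p := by
  have h : ∃ p ∈ K, ∀ z ∈ K, ‖y - p‖ ≤ ‖y - z‖ := ⟨p, hp, hmin⟩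
  have h2 : nearestPt K y = h.choose := by
    unfold nearestPt
    exact dif_pos h
  rw [h2]
  obtain ⟨hq, hqmin⟩ := h.choose_spec
  set r := h.choose
  have he : ‖y - r‖ = ‖y - p‖ := le_antisymm (hqmin p hp) (hmin r hq)
  have hm : (1 / 2 : ℝ) • r + (1 / 2 : ℝ) • p ∈ K :=
    hK hq hp (by norm_num) (by norm_num) (by norm_num)
  have h3 := hmin _ hm
  have h4 : y - ((1 / 2 : ℝ) • r + (1 / 2 : ℝ) • p)
      = (1 / 2 : ℝ) • ((y - r) + (y - p)) := by module
  rw [h4, norm_smul] at h3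
  have h5 := parallelogram_law_with_norm ℝ (y - r) (y - p)
  have h6 : (y - r) - (y - p) = p - r := by abel
  rw [h6, he] at h5
  have h7 : ‖(1 / 2 : ℝ)‖ = 1 / 2 := by norm_num
  rw [h7] at h3
  have h8 : 0 ≤ ‖y - p‖ := norm_nonneg _
  have h9 : ‖p - r‖ = 0 := by
    have := norm_nonneg (p - r)
    nlinarith
  exact (sub_eq_zero.mp (norm_eq_zero.mp h9)).symm

/-- Data of the quadratic program
`min ½ xᵀ H x - cᵀ x` subject to `qᵀ x = b`, `l ≤ x ≤ u`.
As `l i < u i`, a lower bound is real or `-∞` and an upper bound is real or `+∞`. -/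
structure SLBQP (n : ℕ) where
  H : Matrix (Fin n) (Fin n) ℝ
  H_symm : H.IsSymm
  c : EuclideanSpace ℝ (Fin n)
  q : EuclideanSpace ℝ (Fin n)
  b : ℝ
  l : Fin n → EReal
  u : Fin n → EReal
  l_lt_u : ∀ i, l i < u i

namespace SLBQP

variable {n : ℕ} (P : SLBQP n)

/-- Multiplication by `H`. -/
noncomputable def hmul (x : EuclideanSpace ℝ (Fin n)) : EuclideanSpace ℝ (Fin n) :=
  WithLp.toLp 2 (P.H.mulVec x.ofLp)

/-- The objective function. -/
noncomputable def f (x : EuclideanSpace ℝ (Fin n)) : ℝ :=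
  1 / 2 * inner ℝ x (P.hmul x) - inner ℝ P.c x

/-- The gradient `H x - c` of the objective function; see `hasGradientAt_f`. -/
noncomputable def grad (x : EuclideanSpace ℝ (Fin n)) : EuclideanSpace ℝ (Fin n) :=
  P.hmul x - P.c

/-- The feasible set `Ω`. -/
def feasible : Set (EuclideanSpace ℝ (Fin n)) :=
  {x | inner ℝ P.q x = P.b ∧ ∀ i, P.l i ≤ (x i : EReal) ∧ (x i : EReal) ≤ P.u i}

/-- `𝒜_l(x)`. -/
def activeLower (x : EuclideanSpace ℝ (Fin n)) : Set (Fin n) := {i | (x i : EReal) = P.l i}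

/-- `𝒜_u(x)`. -/
def activeUpper (x : EuclideanSpace ℝ (Fin n)) : Set (Fin n) := {i | (x i : EReal) = P.u i}

/-- The active set `𝒜(x)`. -/
def active (x : EuclideanSpace ℝ (Fin n)) : Set (Fin n) := P.activeLower x ∪ P.activeUpper x

/-- The free set `ℱ(x)`. -/
def free (x : EuclideanSpace ℝ (Fin n)) : Set (Fin n) := (P.active x)ᶜ

/-- `𝒜(x) ⊆ 𝒜(y)`, understood side by side: both `𝒜_l(x) ⊆ 𝒜_l(y)` and `𝒜_u(x) ⊆ 𝒜_u(y)`. -/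
def ActiveSubset (x y : EuclideanSpace ℝ (Fin n)) : Prop :=
  P.activeLower x ⊆ P.activeLower y ∧ P.activeUpper x ⊆ P.activeUpper y

/-- The affine hull `Ω(x)` of the face of the feasible set given by the active set at `x`. -/
def faceHull (x : EuclideanSpace ℝ (Fin n)) : Set (EuclideanSpace ℝ (Fin n)) :=
  {v | inner ℝ P.q v = P.b ∧ ∀ i ∈ P.active x, v i = x i}

/-- The direction space `Ω₀(x)` of that affine hull. -/
def faceDir (x : EuclideanSpace ℝ (Fin n)) : Set (EuclideanSpace ℝ (Fin n)) :=
  {v | inner ℝ P.q v = 0 ∧ ∀ i ∈ P.active x, v i = 0}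

/-- The tangent cone `T_Ω(x)`. -/
def tangentCone (x : EuclideanSpace ℝ (Fin n)) : Set (EuclideanSpace ℝ (Fin n)) :=
  {v | inner ℝ P.q v = 0 ∧ (∀ i ∈ P.activeLower x, 0 ≤ v i) ∧ (∀ i ∈ P.activeUpper x, v i ≤ 0)}

/-- The projected gradient `∇_Ω f(x)`: the minimizer of `‖v + ∇f(x)‖` over `v ∈ T_Ω(x)`. -/
noncomputable def projGrad (x : EuclideanSpace ℝ (Fin n)) : EuclideanSpace ℝ (Fin n) :=
  nearestPt (P.tangentCone x) (-P.grad x)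

/-- The multiplier estimate `ρ(x)`. -/
noncomputable def rho (x : EuclideanSpace ℝ (Fin n)) : ℝ :=
  open Classical in
  if ∀ i ∈ P.free x, P.q i = 0 then 0
  else (∑ i with i ∈ P.free x, P.q i * P.grad x i) / (∑ i with i ∈ P.free x, P.q i * P.q i)

/-- `h(x) = ∇f(x) - ρ(x) q`. -/
noncomputable def hvec (x : EuclideanSpace ℝ (Fin n)) : EuclideanSpace ℝ (Fin n) :=
  P.grad x - P.rho x • P.q

/-- The free gradient `φ(x)`. -/
noncomputable def freeGrad (x : EuclideanSpace ℝ (Fin n)) : EuclideanSpace ℝ (Fin n) :=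
  open Classical in
  WithLp.toLp 2 fun i => if i ∈ P.free x then P.hvec x i else 0

/-- The chopped gradient `β(x)`. -/
noncomputable def choppedGrad (x : EuclideanSpace ℝ (Fin n)) : EuclideanSpace ℝ (Fin n) :=
  -P.projGrad x - P.freeGrad x

/-- `x` is proportional with constant `Γ`: `‖β(x)‖_∞ ≤ Γ ‖φ(x)‖₂`. (The norm on `Fin n → ℝ` is
the maximum norm.) -/
def Proportional (Γ : ℝ) (x : EuclideanSpace ℝ (Fin n)) : Prop :=
  ‖(P.choppedGrad x).ofLp‖ ≤ Γ * ‖P.freeGrad x‖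

/-- `ρ` and `lam` are Lagrange multipliers at the feasible point `x`: `lam` is supported on
`𝒜(x)`, `∇f(x) = ∑ lam i eᵢ + ρ q`, with `lam i ≥ 0` on `𝒜_l(x)` and `lam i ≤ 0` on `𝒜_u(x)`. -/
def IsMultiplier (x : EuclideanSpace ℝ (Fin n)) (ρ : ℝ) (lam : Fin n → ℝ) : Prop :=
  (∀ i ∈ P.free x, lam i = 0) ∧
  P.grad x = WithLp.toLp 2 lam + ρ • P.q ∧
  (∀ i ∈ P.activeLower x, 0 ≤ lam i) ∧ (∀ i ∈ P.activeUpper x, lam i ≤ 0)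

/-- The positive `α` such that `x + α d` is feasible. -/
def feasibleSteps (x d : EuclideanSpace ℝ (Fin n)) : Set ℝ :=
  {α | 0 < α ∧ x + α • d ∈ P.feasible}

theorem hasGradientAt_f (x : EuclideanSpace ℝ (Fin n)) : HasGradientAt P.f (P.grad x) x := by
  have hL : ∀ z, P.hmul z = Matrix.toEuclideanCLM (𝕜 := ℝ) P.H z := fun z => rfl
  have hs : ∀ z w, inner ℝ z (P.hmul w) = inner ℝ (P.hmul z) w := by
    intro z w
    simp only [hmul, EuclideanSpace.inner_eq_star_dotProduct, star_trivial]
    rw [dotProduct_comm, Matrix.dotProduct_mulVec, ← Matrix.mulVec_transpose, P.H_symm.eq,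
      dotProduct_comm]
  rw [hasGradientAt_iff_hasFDerivAt]
  have h1 : HasFDerivAt (fun z => P.hmul z) (Matrix.toEuclideanCLM (𝕜 := ℝ) P.H) x := by
    simp only [hL]
    exact (Matrix.toEuclideanCLM (𝕜 := ℝ) P.H).hasFDerivAt
  have h2 := (((hasFDerivAt_id x).inner ℝ h1).const_mul (1 / 2 : ℝ)).sub
    ((hasFDerivAt_const P.c x).inner ℝ (hasFDerivAt_id x))
  refine h2.congr_fderiv ?_
  ext w
  have h3 := hs x w
  simp only [hL] at h3
  simp [grad, hL, h3, real_inner_comm]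
  ring

end SLBQP

/-- Constants of the method: the tolerance, `η`, `Γ`, and the constants of the sufficient decrease
condition. -/
structure P2GPParams where
  tol : ℝ
  η : ℝ
  Γ : ℝ
  γ₁ : ℝ
  γ₂ : ℝ
  γ₃ : ℝ
  μ₁ : ℝ
  μ₂ : ℝ
  tol_nonneg : 0 ≤ tol
  η_mem : η ∈ Set.Ioo (0 : ℝ) 1
  Γ_pos : 0 < Γ
  γ₁_pos : 0 < γ₁
  γ₂_pos : 0 < γ₂
  γ₃_pos : 0 < γ₃
  μ₁_mem : μ₁ ∈ Set.Ioo (0 : ℝ) 1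
  μ₂_mem : μ₂ ∈ Set.Ioo (0 : ℝ) 1

/-- What the method does with the current iterate: a gradient projection step of the identification
phase, a step of the minimization phase, or nothing because it has returned the iterate (`conv`) or
has reported that the problem is unbounded (`unbnd`). -/
inductive P2GPPhase
  | identification
  | minimization
  | converged
  | unbounded

namespace SLBQP

variable {n : ℕ} (P : SLBQP n) (θ : P2GPParams)

/-- The test `conv`: `‖φ(x) + β(x)‖ ≤ tol`. -/
def Conv (x : EuclideanSpace ℝ (Fin n)) : Prop :=
  ‖P.freeGrad x + P.choppedGrad x‖ ≤ θ.tol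

/-- `x(α) = P_Ω(x - α ∇f(x))`. -/
noncomputable def gpPoint (x : EuclideanSpace ℝ (Fin n)) (α : ℝ) : EuclideanSpace ℝ (Fin n) :=
  nearestPt P.feasible (x - α • P.grad x)

/-- `α` satisfies the sufficient decrease condition of the gradient projection step at `x`. -/
def SuffDecrease (x : EuclideanSpace ℝ (Fin n)) (α : ℝ) : Prop :=
  P.f (P.gpPoint x α) ≤ P.f x + θ.μ₁ * inner ℝ (P.grad x) (P.gpPoint x α - x) ∧
  α ≤ θ.γ₁ ∧
  (θ.γ₂ ≤ α ∨ ∃ a : ℝ, θ.γ₃ * a ≤ α ∧ 0 < θ.γ₃ * a ∧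
    P.f x + θ.μ₂ * inner ℝ (P.grad x) (P.gpPoint x a - x) < P.f (P.gpPoint x a))

/-- The test for unboundedness in the identification phase: nonpositive curvature along the
projected gradient, and no largest feasible step along it. -/
def IdentUnbounded (x : EuclideanSpace ℝ (Fin n)) : Prop :=
  inner ℝ (P.projGrad x) (P.hmul (P.projGrad x)) ≤ 0 ∧
  ¬ BddAbove (P.feasibleSteps x (P.projGrad x))

/-- The identification phase that started at iteration `m` goes on after step `k` (if the
convergence test fails at `x (k + 1)`): the active set has changed (lower and upper part taken
together as a pair), and `f(x^k) - f(x^{k+1}) > η max_{m ≤ j < k} (f(x^j) - f(x^{j+1}))`. -/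
def IdentContinues (x : ℕ → EuclideanSpace ℝ (Fin n)) (m k : ℕ) : Prop :=
  ¬ (P.activeLower (x (k + 1)) = P.activeLower (x k) ∧
      P.activeUpper (x (k + 1)) = P.activeUpper (x k)) ∧
  ∀ j, m ≤ j → j < k → θ.η * (P.f (x j) - P.f (x (j + 1))) < P.f (x k) - P.f (x (k + 1))

/-- Passage from iteration `k` to iteration `k + 1`. Here `phase k` says what is done with `x k`,
and `m k` is the iteration at which the current identification phase started. The accuracy of the
approximate minimizer `d` over the face is left open, as in the method. A stopped run stays where
it is. -/
def P2GPStep (x : ℕ → EuclideanSpace ℝ (Fin n)) (phase : ℕ → P2GPPhase) (m : ℕ → ℕ) (k : ℕ) :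
    Prop :=
  open Classical in
  match phase k with
  | .identification =>
      (P.IdentUnbounded (x k) ∧ x (k + 1) = x k ∧ phase (k + 1) = .unbounded) ∨
      (¬ P.IdentUnbounded (x k) ∧
        (∃ α : ℝ, P.SuffDecrease θ (x k) α ∧ x (k + 1) = P.gpPoint (x k) α) ∧
        m (k + 1) = m k ∧
        phase (k + 1) =
          if P.Conv θ (x (k + 1)) then .converged
          else if P.IdentContinues θ x (m k) k then .identification
          else .minimization)
  | .minimization =>
      ∃ d ∈ P.faceDir (x k),
        (inner ℝ d (P.hmul d) ≤ 0 ∧ ¬ BddAbove (P.feasibleSteps (x k) d) ∧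
          x (k + 1) = x k ∧ phase (k + 1) = .unbounded) ∨
        (inner ℝ d (P.hmul d) ≤ 0 ∧
          (∃ α : ℝ, IsGreatest (P.feasibleSteps (x k) d) α ∧ x (k + 1) = x k + α • d) ∧
          m (k + 1) = k + 1 ∧
          phase (k + 1) = if P.Conv θ (x (k + 1)) then .converged else .identification) ∨
        (0 < inner ℝ d (P.hmul d) ∧
          (∃ α : ℝ, 0 < α ∧
            x (k + 1) = nearestPt (P.feasible ∩ P.faceHull (x k)) (x k + α • d)) ∧
          P.f (x (k + 1)) < P.f (x k) ∧
          m (k + 1) = k + 1 ∧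
          phase (k + 1) =
            if P.Conv θ (x (k + 1)) then .converged
            else if P.Proportional θ.Γ (x (k + 1)) then .minimization
            else .identification)
  | .converged => x (k + 1) = x k ∧ phase (k + 1) = .converged
  | .unbounded => x (k + 1) = x k ∧ phase (k + 1) = .unbounded

/-- `x` is a sequence generated by the method, with the bookkeeping `phase` and `m` of its control
flow. -/
structure IsP2GPRun (x : ℕ → EuclideanSpace ℝ (Fin n)) (phase : ℕ → P2GPPhase) (m : ℕ → ℕ) :
    Prop where
  start_mem : x 0 ∈ P.feasible
  start_phase : open Classical in
    phase 0 = if P.Conv θ (x 0) then .converged else .identification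
  start_m : m 0 = 0
  step : ∀ k, P.P2GPStep θ x phase m k

end SLBQP

/-- The set `K_GP` of gradient projection iterations: those `k` for which `x (k + 1)` is produced
by the gradient projection step of an identification phase. -/
def gpIterations (phase : ℕ → P2GPPhase) : Set ℕ :=
  {k | phase k = .identification ∧ phase (k + 1) ≠ .unbounded}

/-! Convergence comes from the gradient projection iterations alone. Write `s` for such a step from
`x k`. Sufficient decrease bounds `‖s‖ ^ 2` by a multiple of the decrease of `f`; as `f` is
nonincreasing along the run and bounded below on Ω, `s → 0` along K_GP (`tendsto_step_zero`). The
step lengths `α` are bounded below (`exists_stepsize_lower_bound`), so the variational inequality of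
the projection, tested at the solution and combined with convexity, gives `f (x k) - f xs ≤ C *
‖s‖`. Hence the monotone values tend to `f xs` (`tendsto_f`), and strict convexity turns this into
convergence of the iterates through a growth estimate (`exists_growth`). In the limit no active
bound is outside the active set of `xs`, by continuity.

For the other inclusion, `x (k + 1)` minimizes over Ω the linear form given by `w k = ∇f (x k) + α⁻¹
• s`, and `w k → ∇f xs`. A linear form that is minimal at a point is minimal on the whole face of
that point. There are finitely many faces; on one that is visited infinitely often, passing to the
limit shows that `∇f xs` is minimal there, and the multipliers then force the coordinates with
nonzero multiplier to equal those of `xs` exactly (`eventually_eq_of_gpIterations`). All other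
iterations only enlarge the active set (`step_cases`), so the identified bounds stay active.

If the run stops with zero tolerance, the projected gradient vanishes and the iterate is the
solution (`eq_of_projGrad_eq_zero`). -/

open Filter Topology

/-- The variational inequality for the projection onto a closed convex set. -/
theorem inner_sub_nearestPt_le_zero {E : Type*} [NormedAddCommGroup E] [InnerProductSpace ℝ E]
    [ProperSpace E] {K : Set E} (hne : K.Nonempty) (hcl : IsClosed K) (hK : Convex ℝ K) (y : E)
    {z : E} (hz : z ∈ K) : inner ℝ (y - nearestPt K y) (z - nearestPt K y) ≤ 0 := by
  obtain ⟨hp, hmin⟩ := nearestPt_spec hne hcl y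
  refine (norm_eq_iInf_iff_real_inner_le_zero hK hp).1 ?_ z hz
  have : Nonempty K := hne.to_subtype
  refine le_antisymm (le_ciInf fun w => hmin w w.2) ?_
  exact ciInf_le (f := fun w : K => ‖y - w‖) ⟨0, by rintro _ ⟨w, rfl⟩; positivity⟩ ⟨_, hp⟩

namespace SLBQP

variable {n : ℕ} (P : SLBQP n)

/-! ### The quadratic objective, the feasible set and the tangent cone -/

theorem hmul_eq_toEuclideanCLM (x : EuclideanSpace ℝ (Fin n)) :
    P.hmul x = Matrix.toEuclideanCLM (𝕜 := ℝ) P.H x := rfl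

theorem inner_hmul_comm (z w : EuclideanSpace ℝ (Fin n)) :
    inner ℝ z (P.hmul w) = inner ℝ w (P.hmul z) := by
  simp only [hmul, EuclideanSpace.inner_eq_star_dotProduct, star_trivial]
  rw [dotProduct_comm, Matrix.dotProduct_mulVec, ← Matrix.mulVec_transpose, P.H_symm.eq]

theorem hmul_add (x y : EuclideanSpace ℝ (Fin n)) : P.hmul (x + y) = P.hmul x + P.hmul y := by
  simp [hmul_eq_toEuclideanCLM]

theorem hmul_smul (a : ℝ) (x : EuclideanSpace ℝ (Fin n)) : P.hmul (a • x) = a • P.hmul x := by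
  simp [hmul_eq_toEuclideanCLM]

theorem continuous_grad : Continuous P.grad :=
  (Matrix.toEuclideanCLM (𝕜 := ℝ) P.H).continuous.sub continuous_const

theorem continuous_f : Continuous P.f := by
  have : Continuous P.hmul := (Matrix.toEuclideanCLM (𝕜 := ℝ) P.H).continuous
  unfold f
  fun_prop

theorem exists_curvature_bound :
    ∃ L > 0, ∀ s : EuclideanSpace ℝ (Fin n), inner ℝ s (P.hmul s) ≤ L * ‖s‖ ^ 2 := by
  -- The summand 1 keeps the constant positive when `H = 0`.
  refine ⟨‖Matrix.toEuclideanCLM (𝕜 := ℝ) P.H‖ + 1, by positivity, fun s => ?_⟩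
  have h1 := real_inner_le_norm s (P.hmul s)
  have h2 := (Matrix.toEuclideanCLM (𝕜 := ℝ) P.H).le_opNorm s
  rw [← hmul_eq_toEuclideanCLM] at h2
  nlinarith [norm_nonneg s, mul_le_mul_of_nonneg_left h2 (norm_nonneg s)]

theorem f_add (x s : EuclideanSpace ℝ (Fin n)) :
    P.f (x + s) = P.f x + inner ℝ (P.grad x) s + 1 / 2 * inner ℝ s (P.hmul s) := by
  have h1 := P.inner_hmul_comm s x
  have h2 := real_inner_comm s (P.hmul x)
  simp only [f, grad, hmul_add, inner_add_left, inner_add_right, inner_sub_left]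
  linarith

theorem f_eq (x y : EuclideanSpace ℝ (Fin n)) :
    P.f y = P.f x + inner ℝ (P.grad x) (y - x) + 1 / 2 * inner ℝ (y - x) (P.hmul (y - x)) := by
  rw [← f_add, add_sub_cancel]

theorem continuous_coord (i : Fin n) :
    Continuous fun x : EuclideanSpace ℝ (Fin n) => (x i : EReal) :=
  continuous_coe_real_ereal.comp (by fun_prop)

theorem isClosed_feasible : IsClosed P.feasible := by
  have : P.feasible = {x | inner ℝ P.q x = P.b} ∩
      ⋂ i, ({x | P.l i ≤ (x i : EReal)} ∩ {x | (x i : EReal) ≤ P.u i}) := by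
    ext x; simp [feasible]
  rw [this]
  refine (isClosed_eq (by fun_prop) continuous_const).inter (isClosed_iInter fun i => ?_)
  exact (isClosed_le continuous_const (continuous_coord i)).inter
    (isClosed_le (continuous_coord i) continuous_const)

theorem isClosed_tangentCone (x : EuclideanSpace ℝ (Fin n)) : IsClosed (P.tangentCone x) := by
  have : P.tangentCone x = {v | inner ℝ P.q v = 0} ∩
      ((⋂ i ∈ P.activeLower x, {v | 0 ≤ v i}) ∩ ⋂ i ∈ P.activeUpper x, {v | v i ≤ 0}) := by
    ext x; simp [tangentCone]
  rw [this]
  refine (isClosed_eq (by fun_prop) continuous_const).inter (.inter ?_ ?_)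
  · exact isClosed_biInter fun i _ => isClosed_le (by fun_prop) (by fun_prop)
  · exact isClosed_biInter fun i _ => isClosed_le (by fun_prop) (by fun_prop)

theorem convex_tangentCone (x : EuclideanSpace ℝ (Fin n)) : Convex ℝ (P.tangentCone x) := by
  rintro v ⟨hv, hvl, hvu⟩ w ⟨hw, hwl, hwu⟩ a c ha hc -
  refine ⟨by simp [inner_add_right, inner_smul_right, hv, hw], fun i hi => ?_, fun i hi => ?_⟩
  · have := hvl i hi; have := hwl i hi
    simp only [PiLp.add_apply, PiLp.smul_apply, smul_eq_mul]; positivity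
  · have := mul_nonneg ha (neg_nonneg.2 (hvu i hi))
    have := mul_nonneg hc (neg_nonneg.2 (hwu i hi))
    simp only [PiLp.add_apply, PiLp.smul_apply, smul_eq_mul]; linarith

variable {P}

theorem sub_mem_tangentCone {x z : EuclideanSpace ℝ (Fin n)} (hx : x ∈ P.feasible)
    (hz : z ∈ P.feasible) : z - x ∈ P.tangentCone x := by
  refine ⟨by rw [inner_sub_right, hz.1, hx.1, sub_self], fun i hi => ?_, fun i hi => ?_⟩
  · have h := (hz.2 i).1
    rw [← show (x i : EReal) = P.l i from hi, EReal.coe_le_coe_iff] at h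
    simpa using h
  · have h := (hz.2 i).2
    rw [← show (x i : EReal) = P.u i from hi, EReal.coe_le_coe_iff] at h
    simpa using h

theorem inner_grad_nonneg_of_projGrad_eq_zero {x v : EuclideanSpace ℝ (Fin n)}
    (h : P.projGrad x = 0) (hv : v ∈ P.tangentCone x) : 0 ≤ inner ℝ (P.grad x) v := by
  have := inner_sub_nearestPt_le_zero ⟨v, hv⟩ (P.isClosed_tangentCone x) (P.convex_tangentCone x)
    (-P.grad x) hv
  rw [projGrad] at h
  simpa [h] using this

/-! ### Consequences of strict convexity on Ω -/

section Convexity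

variable (hc : StrictConvexOn ℝ P.feasible P.f)
include hc

/-- The convexity gap at the midpoint of `x` and `x + s` is one eighth of the curvature along `s`.
Only differences of feasible points are covered; `H` itself may be indefinite. -/
theorem curvature_pos {x s : EuclideanSpace ℝ (Fin n)} (hx : x ∈ P.feasible)
    (hxs : x + s ∈ P.feasible) (hs : s ≠ 0) : 0 < inner ℝ s (P.hmul s) := by
  have h := hc.2 hx hxs (by simpa using hs) (show (0 : ℝ) < 1 / 2 by norm_num)
    (show (0 : ℝ) < 1 / 2 by norm_num) (by norm_num)
  rw [show (1 / 2 : ℝ) • x + (1 / 2 : ℝ) • (x + s) = x + (1 / 2 : ℝ) • s by module,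
    f_add, f_add] at h
  simp only [hmul_smul, inner_smul_left, inner_smul_right, smul_eq_mul, RCLike.conj_to_real] at h
  linarith

theorem f_add_inner_grad_le {x y : EuclideanSpace ℝ (Fin n)} (hx : x ∈ P.feasible)
    (hy : y ∈ P.feasible) : P.f x + inner ℝ (P.grad x) (y - x) ≤ P.f y := by
  have h : 0 ≤ inner ℝ (y - x) (P.hmul (y - x)) := by
    rcases eq_or_ne (y - x) 0 with h0 | h0
    · simp [h0]
    · exact (curvature_pos hc hx (by simpa using hy) h0).le
  rw [P.f_eq x y]
  linarith

variable {xs : EuclideanSpace ℝ (Fin n)} (hxs : xs ∈ P.feasible) (hmin : IsMinOn P.f P.feasible xs)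
include hxs hmin

theorem f_lt_of_ne {y : EuclideanSpace ℝ (Fin n)} (hy : y ∈ P.feasible) (hne : y ≠ xs) :
    P.f xs < P.f y := by
  refine lt_of_le_of_ne (hmin hy) fun he => hne ?_
  exact hc.eq_of_isMinOn (fun z hz => by simpa [← he] using hmin hz) hmin hy hxs

/-- Linear growth of the objective function away from its minimizer. -/
theorem exists_growth {r : ℝ} (hr : 0 < r) :
    ∃ δ > 0, ∀ y ∈ P.feasible, r ≤ ‖y - xs‖ → δ * ‖y - xs‖ ≤ P.f y - P.f xs := by
  -- On the compact sphere of radius `r` the gap has a positive minimum; convexity along the segment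
  -- from `xs` to `y` carries it outward in proportion to the distance.
  have key : ∃ δ > 0, ∀ z ∈ P.feasible ∩ Metric.sphere xs r, P.f xs + δ ≤ P.f z := by
    have hcomp : IsCompact (P.feasible ∩ Metric.sphere xs r) :=
      (isCompact_sphere xs r).inter_left P.isClosed_feasible
    rcases (P.feasible ∩ Metric.sphere xs r).eq_empty_or_nonempty with he | hne
    · exact ⟨1, one_pos, by simp [he]⟩
    · obtain ⟨w, hw, hwm⟩ := hcomp.exists_isMinOn hne P.continuous_f.continuousOn
      have hwne : w ≠ xs := by
        rintro rfl
        have := hw.2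
        simp at this
        exact hr.ne this
      refine ⟨P.f w - P.f xs, sub_pos.2 (f_lt_of_ne hc hxs hmin hw.1 hwne), fun z hz => ?_⟩
      have : P.f w ≤ P.f z := hwm hz
      linarith
  obtain ⟨δ, hδ, hδz⟩ := key
  refine ⟨δ / r, by positivity, fun y hy hyr => ?_⟩
  have hR : 0 < ‖y - xs‖ := hr.trans_le hyr
  set t := r / ‖y - xs‖ with ht
  have ht0 : 0 < t := by positivity
  have ht1 : t ≤ 1 := (div_le_one hR).2 hyr
  have hz := hc.1 hxs hy (sub_nonneg.2 ht1) ht0.le (by ring)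
  have hfz := hc.convexOn.2 hxs hy (sub_nonneg.2 ht1) ht0.le (by ring)
  have hsph : (1 - t) • xs + t • y ∈ Metric.sphere xs r := by
    rw [mem_sphere_iff_norm, show (1 - t) • xs + t • y - xs = t • (y - xs) by module, norm_smul,
      Real.norm_of_nonneg ht0.le, ht, div_mul_cancel₀ _ hR.ne']
  have h := hδz _ ⟨hz, hsph⟩
  simp only [smul_eq_mul] at hfz
  have h2 : δ ≤ t * (P.f y - P.f xs) := by linarith
  rw [ht, div_mul_eq_mul_div, le_div_iff₀ hR] at h2
  rw [div_mul_eq_mul_div, div_le_iff₀ hr]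
  linarith

theorem tendsto_of_tendsto_f {ι : Type*} {F : Filter ι} {y : ι → EuclideanSpace ℝ (Fin n)}
    (hy : ∀ k, y k ∈ P.feasible) (hf : Tendsto (fun k => P.f (y k)) F (𝓝 (P.f xs))) :
    Tendsto y F (𝓝 xs) := by
  rw [Metric.tendsto_nhds]
  intro ε hε
  obtain ⟨δ, hδ, h⟩ := exists_growth hc hxs hmin hε
  filter_upwards [hf.eventually_lt_const (show P.f xs < P.f xs + δ * ε by nlinarith)] with k hk
  by_contra! hcon
  rw [dist_eq_norm] at hcon
  nlinarith [h _ (hy k) hcon]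

/-- Linear growth makes sublevel sets bounded, even when Ω is unbounded. -/
theorem exists_norm_sub_le (M : ℝ) :
    ∃ R, ∀ y ∈ P.feasible, P.f y ≤ M → ‖y - xs‖ ≤ R := by
  obtain ⟨δ, hδ, h⟩ := exists_growth hc hxs hmin one_pos
  refine ⟨max 1 ((M - P.f xs) / δ), fun y hy hyM => ?_⟩
  rcases le_total ‖y - xs‖ 1 with h1 | h1
  · exact h1.trans (le_max_left _ _)
  · refine le_trans ?_ (le_max_right _ _)
    rw [le_div_iff₀ hδ]
    linarith [h y hy h1]

theorem eq_of_projGrad_eq_zero {x : EuclideanSpace ℝ (Fin n)} (hx : x ∈ P.feasible)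
    (h : P.projGrad x = 0) : x = xs := by
  by_contra hne
  have h1 := inner_grad_nonneg_of_projGrad_eq_zero h (sub_mem_tangentCone hx hxs)
  have h2 := f_add_inner_grad_le hc hx hxs
  linarith [f_lt_of_ne hc hxs hmin hx hne]

end Convexity

/-! ### Gradient projection steps and their step lengths -/

section GradientProjection

theorem gpPoint_mem {x : EuclideanSpace ℝ (Fin n)} (hx : x ∈ P.feasible) (α : ℝ) :
    P.gpPoint x α ∈ P.feasible :=
  (nearestPt_spec ⟨x, hx⟩ P.isClosed_feasible _).1

variable (hK : Convex ℝ P.feasible) {x : EuclideanSpace ℝ (Fin n)} (hx : x ∈ P.feasible)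
include hK hx

/-- This is the variational inequality of the projection divided by `α`: the new point minimizes a
linear form over Ω. Both the convergence of `f` and the identification rest on it. -/
theorem gpPoint_inner_nonneg {α : ℝ} (hα : 0 < α) {z : EuclideanSpace ℝ (Fin n)}
    (hz : z ∈ P.feasible) :
    0 ≤ inner ℝ (P.grad x + α⁻¹ • (P.gpPoint x α - x)) (z - P.gpPoint x α) := by
  have h := inner_sub_nearestPt_le_zero ⟨x, hx⟩ P.isClosed_feasible hK (x - α • P.grad x) hz
  rw [← gpPoint, show x - α • P.grad x - P.gpPoint x α =
    (-α) • (P.grad x + α⁻¹ • (P.gpPoint x α - x)) by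
      rw [smul_add, smul_smul, neg_mul, mul_inv_cancel₀ hα.ne']; module, inner_smul_left] at h
  simp only [RCLike.conj_to_real] at h
  nlinarith

theorem norm_sq_gpPoint_sub_le {α : ℝ} (hα : 0 < α) :
    ‖P.gpPoint x α - x‖ ^ 2 ≤ -(α * inner ℝ (P.grad x) (P.gpPoint x α - x)) := by
  have h := gpPoint_inner_nonneg hK hx hα hx
  rw [← neg_sub (P.gpPoint x α) x, inner_neg_right, inner_add_left, inner_smul_left,
    real_inner_self_eq_norm_sq] at h
  simp only [RCLike.conj_to_real] at h
  have : α * (α⁻¹ * ‖P.gpPoint x α - x‖ ^ 2) = ‖P.gpPoint x α - x‖ ^ 2 := by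
    field_simp
  nlinarith

/-- A step that violates the sufficient decrease condition cannot be short. -/
theorem le_of_not_suffDecrease {L μ a : ℝ} (hL : 0 < L)
    (hcurv : ∀ s : EuclideanSpace ℝ (Fin n), inner ℝ s (P.hmul s) ≤ L * ‖s‖ ^ 2)
    (hμ : μ < 1) (ha : 0 < a)
    (h : P.f x + μ * inner ℝ (P.grad x) (P.gpPoint x a - x) < P.f (P.gpPoint x a)) :
    2 * (1 - μ) / L ≤ a := by
  have h1 := norm_sq_gpPoint_sub_le hK hx ha
  rw [P.f_eq x (P.gpPoint x a)] at h
  have h2 := hcurv (P.gpPoint x a - x)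
  set s := P.gpPoint x a - x
  set g := inner ℝ (P.grad x) s
  rw [div_le_iff₀ hL]
  have h3 : (1 - μ) * (-g) < 1 / 2 * (L * ‖s‖ ^ 2) := by linarith
  have h4 : a * ((1 - μ) * (-g)) < a * (1 / 2 * (L * ‖s‖ ^ 2)) := mul_lt_mul_of_pos_left h3 ha
  have h5 : (1 - μ) * ‖s‖ ^ 2 ≤ (1 - μ) * (-(a * g)) :=
    mul_le_mul_of_nonneg_left h1 (by linarith)
  -- The strict inequality also rules out `s = 0`, so the first factor must be positive.
  have h6 : 0 < (a * L / 2 - (1 - μ)) * ‖s‖ ^ 2 := by linarith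
  have h7 := pos_of_mul_pos_left h6 (by positivity)
  linarith

end GradientProjection

theorem SuffDecrease.pos {θ : P2GPParams} {x : EuclideanSpace ℝ (Fin n)} {α : ℝ}
    (h : P.SuffDecrease θ x α) : 0 < α := by
  obtain ⟨-, -, h | ⟨a, h, h', -⟩⟩ := h
  · exact θ.γ₂_pos.trans_le h
  · exact h'.trans_le h

/-- Either `γ₂ ≤ α`, or `α` is at least `γ₃` times a trial step that failed the decrease test, and
such a trial step is bounded below through the curvature bound, uniformly in `x`. -/
theorem exists_stepsize_lower_bound (hK : Convex ℝ P.feasible) (θ : P2GPParams) :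
    ∃ a > 0, ∀ x ∈ P.feasible, ∀ α, P.SuffDecrease θ x α → a ≤ α := by
  obtain ⟨L, hL, hcurv⟩ := P.exists_curvature_bound
  have hμ := θ.μ₂_mem.2
  have h3 := θ.γ₃_pos
  refine ⟨min θ.γ₂ (θ.γ₃ * (2 * (1 - θ.μ₂) / L)), lt_min θ.γ₂_pos ?_, ?_⟩
  · have : 0 < 1 - θ.μ₂ := by linarith
    positivity
  · rintro x hx α ⟨-, -, h | ⟨a, h, h', hf⟩⟩
    · exact (min_le_left _ _).trans h
    · refine (min_le_right _ _).trans (le_trans ?_ h)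
      exact mul_le_mul_of_nonneg_left
        (le_of_not_suffDecrease hK hx hL hcurv hμ (pos_of_mul_pos_right h' h3.le) hf) h3.le

/-! ### Active sets, faces and multipliers -/

section ActiveSets

theorem isClosed_setOf_eq_bound (c : EReal) (i : Fin n) :
    IsClosed {x : EuclideanSpace ℝ (Fin n) | (x i : EReal) = c} :=
  isClosed_eq (continuous_coord i) continuous_const

theorem eventually_activeSubset {ι : Type*} {F : Filter ι} {y : ι → EuclideanSpace ℝ (Fin n)}
    {xs : EuclideanSpace ℝ (Fin n)} (hy : Tendsto y F (𝓝 xs)) :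
    ∀ᶠ k in F, P.ActiveSubset (y k) xs := by
  have key : ∀ c : Fin n → EReal, ∀ᶠ k in F, ∀ i, (y k i : EReal) = c i → (xs i : EReal) = c i := by
    intro c
    rw [eventually_all]
    intro i
    by_cases h : (xs i : EReal) = c i
    · exact Eventually.of_forall fun _ _ => h
    · filter_upwards [hy.eventually ((isClosed_setOf_eq_bound (c i) i).isOpen_compl.mem_nhds h)]
        with k hk hk'
      exact absurd hk' hk
  filter_upwards [key P.l, key P.u] with k h1 h2
  exact ⟨fun i hi => h1 i hi, fun i hi => h2 i hi⟩

theorem activeSubset_of_mem_faceHull {x y : EuclideanSpace ℝ (Fin n)} (hy : y ∈ P.faceHull x) :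
    P.ActiveSubset x y :=
  ⟨fun i hi => by simpa [activeLower, hy.2 i (.inl hi)] using hi,
    fun i hi => by simpa [activeUpper, hy.2 i (.inr hi)] using hi⟩

theorem mem_faceHull_self {x : EuclideanSpace ℝ (Fin n)} (hx : x ∈ P.feasible) :
    x ∈ P.faceHull x := ⟨hx.1, fun _ _ => rfl⟩

theorem isClosed_faceHull (x : EuclideanSpace ℝ (Fin n)) : IsClosed (P.faceHull x) := by
  have : P.faceHull x = {v | inner ℝ P.q v = P.b} ∩ ⋂ i ∈ P.active x, {v | v i = x i} := by
    ext x; simp [faceHull]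
  rw [this]
  refine (isClosed_eq (by fun_prop) continuous_const).inter ?_
  exact isClosed_biInter fun i _ => isClosed_eq (by fun_prop) (by fun_prop)

/-- Every point of the relative interior of a face can be moved away from every point of the
face. -/
theorem exists_pos_extend {x y : EuclideanSpace ℝ (Fin n)} (hx : x ∈ P.feasible)
    (hy : y ∈ P.feasible) (hxy : P.ActiveSubset x y) :
    ∃ t : ℝ, 0 < t ∧ x + t • (x - y) ∈ P.feasible := by
  have key : ∀ i, ∀ᶠ t : ℝ in 𝓝[>] 0, P.l i ≤ ((x + t • (x - y)) i : ℝ) ∧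
      (((x + t • (x - y)) i : ℝ) : EReal) ≤ P.u i := by
    intro i
    -- Coordinates active at `x` agree with those of `y` and do not move; the others satisfy strict
    -- bounds, which survive for small `t`.
    by_cases hi : i ∈ P.active x
    · have he : y i = x i := by
        rcases hi with hi | hi
        · exact EReal.coe_injective ((hxy.1 hi : (y i : EReal) = P.l i).trans hi.symm)
        · exact EReal.coe_injective ((hxy.2 hi : (y i : EReal) = P.u i).trans hi.symm)
      simpa [he] using hx.2 i
    · have hl : P.l i < x i := lt_of_le_of_ne (hx.2 i).1 fun h => hi (.inl h.symm)
      have hu : x i < P.u i := lt_of_le_of_ne (hx.2 i).2 fun h => hi (.inr h)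
      have hcont : Tendsto (fun t : ℝ => (((x + t • (x - y)) i : ℝ) : EReal)) (𝓝[>] 0)
          (𝓝 (x i : EReal)) := by
        have : Continuous fun t : ℝ => (((x + t • (x - y)) i : ℝ) : EReal) :=
          (continuous_coord i).comp (by fun_prop)
        simpa using (this.tendsto 0).mono_left nhdsWithin_le_nhds
      filter_upwards [hcont.eventually_const_lt hl, hcont.eventually_lt_const hu] with t h1 h2
      exact ⟨h1.le, h2.le⟩
  obtain ⟨t, ht, ht0⟩ := ((eventually_all.2 key).and self_mem_nhdsWithin).exists
  exact ⟨t, ht0, by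
    simp [inner_add_right, inner_smul_right, inner_sub_right, hx.1, hy.1], ht⟩

/-- If a linear form attains its minimum over the feasible set at `x`, then so it does at
every point of the face of `x`. -/
theorem inner_sub_nonneg_of_activeSubset {w x y : EuclideanSpace ℝ (Fin n)} (hx : x ∈ P.feasible)
    (hy : y ∈ P.feasible) (hxy : P.ActiveSubset x y)
    (hw : ∀ z ∈ P.feasible, 0 ≤ inner ℝ w (z - x)) {z : EuclideanSpace ℝ (Fin n)}
    (hz : z ∈ P.feasible) : 0 ≤ inner ℝ w (z - y) := by
  obtain ⟨t, ht, hmem⟩ := exists_pos_extend hx hy hxy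
  have h1 := hw _ hmem
  rw [add_sub_cancel_left, inner_smul_right] at h1
  have h2 := nonneg_of_mul_nonneg_right h1 ht
  have h3 := hw z hz
  rw [← sub_add_sub_cancel z x y, inner_add_right]
  linarith

theorem IsMultiplier.mul_nonneg {x y : EuclideanSpace ℝ (Fin n)} {ρ : ℝ} {lam : Fin n → ℝ}
    (hlam : P.IsMultiplier x ρ lam) (hx : x ∈ P.feasible) (hy : y ∈ P.feasible) (i : Fin n) :
    0 ≤ lam i * (y i - x i) := by
  have hT := sub_mem_tangentCone hx hy
  by_cases hi : i ∈ P.active x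
  · rcases hi with hi | hi
    · exact _root_.mul_nonneg (hlam.2.2.1 i hi) (hT.2.1 i hi)
    · exact mul_nonneg_of_nonpos_of_nonpos (hlam.2.2.2 i hi) (hT.2.2 i hi)
  · simp [hlam.1 i hi]

/-- A feasible point at which the gradient at `x` is minimal agrees with `x` in the coordinates
with nonzero multipliers. -/
theorem IsMultiplier.eq_of_inner_nonneg {x y : EuclideanSpace ℝ (Fin n)} {ρ : ℝ} {lam : Fin n → ℝ}
    (hlam : P.IsMultiplier x ρ lam) (hx : x ∈ P.feasible) (hy : y ∈ P.feasible)
    (h : 0 ≤ inner ℝ (P.grad x) (x - y)) {i : Fin n} (hi : lam i ≠ 0) : y i = x i := by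
  have hsum : inner ℝ (P.grad x) (y - x) = ∑ j, lam j * (y j - x j) := by
    rw [hlam.2.1, inner_add_left, inner_smul_left, inner_sub_right P.q, hx.1, hy.1, sub_self,
      mul_zero, add_zero]
    simp [PiLp.inner_apply, mul_comm]
  rw [← neg_sub y x, inner_neg_right, hsum, neg_nonneg] at h
  have h0 := (Finset.sum_eq_zero_iff_of_nonneg fun j _ => hlam.mul_nonneg hx hy j).1
    (le_antisymm h (Finset.sum_nonneg fun j _ => hlam.mul_nonneg hx hy j)) i (Finset.mem_univ i)
  exact sub_eq_zero.1 ((mul_eq_zero.1 h0).resolve_left hi)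

end ActiveSets

/-! ### Feasibility, monotonicity and stopping of a run -/

section Run

variable {θ : P2GPParams} {x : ℕ → EuclideanSpace ℝ (Fin n)} {phase : ℕ → P2GPPhase} {m : ℕ → ℕ}

/-- One iteration of a run on a strictly convex problem, without the control flow. -/
theorem IsP2GPRun.step_cases (hrun : P.IsP2GPRun θ x phase m)
    (hc : StrictConvexOn ℝ P.feasible P.f) {k : ℕ} (hx : x k ∈ P.feasible) :
    (k ∈ gpIterations phase ∧ ∃ α, P.SuffDecrease θ (x k) α ∧ x (k + 1) = P.gpPoint (x k) α) ∨
    (k ∉ gpIterations phase ∧ x (k + 1) ∈ P.feasible ∧ P.f (x (k + 1)) ≤ P.f (x k) ∧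
      P.ActiveSubset (x k) (x (k + 1))) := by
  have hs := hrun.step k
  unfold P2GPStep at hs
  have stay : x (k + 1) = x k → x (k + 1) ∈ P.feasible ∧ P.f (x (k + 1)) ≤ P.f (x k) ∧
      P.ActiveSubset (x k) (x (k + 1)) := by
    intro h
    rw [h]
    exact ⟨hx, le_rfl, subset_rfl, subset_rfl⟩
  rcases hp : phase k <;> simp only [hp] at hs
  · rcases hs with ⟨-, h, h'⟩ | ⟨-, h, -, h'⟩
    · exact .inr ⟨fun hk => hk.2 h', stay h⟩
    · refine .inl ⟨⟨hp, ?_⟩, h⟩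
      rw [h']
      split_ifs <;> simp
  · refine .inr ⟨fun hk => absurd (hk.1.symm.trans hp) (by simp), ?_⟩
    obtain ⟨d, hd, ⟨-, -, h, -⟩ | ⟨hcurv, ⟨α, ⟨⟨hα, hmem⟩, hub⟩, -⟩, -⟩ | ⟨-, ⟨α, -, h⟩, hf, -⟩⟩ := hs
    · exact stay h
    -- A maximal step along nonpositive curvature cannot occur: for `d = 0` there is no largest
    -- feasible step, and for `d ≠ 0` the curvature is positive.
    · rcases eq_or_ne d 0 with rfl | hd0
      · have := hub (show α + 1 ∈ P.feasibleSteps (x k) 0 from ⟨by linarith, by simpa using hx⟩)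
        linarith
      · have := curvature_pos hc hx hmem (smul_ne_zero hα.ne' hd0)
        simp only [hmul_smul, inner_smul_left, inner_smul_right, RCLike.conj_to_real] at this
        have := mul_nonpos_of_nonneg_of_nonpos hα.le
          (mul_nonpos_of_nonneg_of_nonpos hα.le hcurv)
        linarith
    · have hmem := (nearestPt_spec
        (K := P.feasible ∩ P.faceHull (x k)) ⟨x k, hx, mem_faceHull_self hx⟩
        (P.isClosed_feasible.inter (isClosed_faceHull (x k))) (x k + α • d)).1
      rw [← h] at hmem
      exact ⟨hmem.1, hf.le, activeSubset_of_mem_faceHull hmem.2⟩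
  · exact .inr ⟨fun hk => absurd (hk.1.symm.trans hp) (by simp), stay hs.1⟩
  · exact .inr ⟨fun hk => absurd (hk.1.symm.trans hp) (by simp), stay hs.1⟩

theorem IsP2GPRun.mem_feasible (hrun : P.IsP2GPRun θ x phase m)
    (hc : StrictConvexOn ℝ P.feasible P.f) (k : ℕ) : x k ∈ P.feasible := by
  induction k with
  | zero => exact hrun.start_mem
  | succ k ih =>
    rcases hrun.step_cases hc ih with ⟨-, α, -, h⟩ | ⟨-, h, -⟩
    · rw [h]
      exact gpPoint_mem ih α
    · exact h

/-- The decrease of the objective function in a gradient projection iteration. -/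
theorem norm_sq_le_of_suffDecrease (hK : Convex ℝ P.feasible) {x : EuclideanSpace ℝ (Fin n)}
    (hx : x ∈ P.feasible) {α : ℝ} (hα : P.SuffDecrease θ x α) :
    ‖P.gpPoint x α - x‖ ^ 2 ≤ θ.γ₁ / θ.μ₁ * (P.f x - P.f (P.gpPoint x α)) := by
  have h1 := norm_sq_gpPoint_sub_le hK hx hα.pos
  have hμ := θ.μ₁_mem.1
  have h2 := hα.1
  have h3 := hα.2.1
  have hα0 := hα.pos
  set s := P.gpPoint x α - x
  set g := inner ℝ (P.grad x) s
  have hg : 0 ≤ -g := by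
    by_contra! hcon
    nlinarith [sq_nonneg ‖s‖]
  rw [div_mul_eq_mul_div, le_div_iff₀ hμ]
  have h4 : θ.μ₁ * -g ≤ P.f x - P.f (P.gpPoint x α) := by linarith
  calc ‖s‖ ^ 2 * θ.μ₁ ≤ -(α * g) * θ.μ₁ := mul_le_mul_of_nonneg_right h1 hμ.le
    _ = α * (θ.μ₁ * -g) := by ring
    _ ≤ θ.γ₁ * (θ.μ₁ * -g) := mul_le_mul_of_nonneg_right h3 (by positivity)
    _ ≤ _ := mul_le_mul_of_nonneg_left h4 θ.γ₁_pos.le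

theorem IsP2GPRun.antitone_f (hrun : P.IsP2GPRun θ x phase m)
    (hc : StrictConvexOn ℝ P.feasible P.f) : Antitone fun k => P.f (x k) := by
  refine antitone_nat_of_succ_le fun k => ?_
  have hx := hrun.mem_feasible hc k
  rcases hrun.step_cases hc hx with ⟨-, α, hα, h⟩ | ⟨-, -, h, -⟩
  · rw [h]
    have h1 := (sq_nonneg _).trans (norm_sq_le_of_suffDecrease hc.1 hx hα)
    have := nonneg_of_mul_nonneg_right h1 (div_pos θ.γ₁_pos θ.μ₁_mem.1)
    linarith
  · exact h

/-- The phase `converged` is entered only through the stopping test, and the iterate does not change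
afterwards. -/
theorem IsP2GPRun.conv (hrun : P.IsP2GPRun θ x phase m) {k : ℕ} (hk : phase k = .converged) :
    P.Conv θ (x k) := by
  induction k with
  | zero =>
    have h := hrun.start_phase
    by_contra hcon
    simp [hk, hcon] at h
  | succ k ih =>
    have hs := hrun.step k
    by_contra hcon
    unfold P2GPStep at hs
    rcases hp : phase k <;> simp only [hp, hk, if_neg hcon] at hs
    · rcases hs with ⟨-, -, h'⟩ | ⟨-, -, -, h'⟩
      · simp at h'
      · split_ifs at h'
    · obtain ⟨d, hd, ⟨-, -, -, h⟩ | ⟨-, -, -, h⟩ | ⟨-, -, -, -, h⟩⟩ := hs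
      · simp at h
      · simp at h
      · split_ifs at h
    · rw [hs.1] at hcon
      exact hcon (ih hp)
    · simp at hs

theorem IsP2GPRun.eq_of_converged (hrun : P.IsP2GPRun θ x phase m) {k : ℕ}
    (hk : phase k = .converged) {j : ℕ} (hj : k ≤ j) :
    x j = x k ∧ phase j = .converged := by
  induction j, hj using Nat.le_induction with
  | base => exact ⟨rfl, hk⟩
  | succ j _ ih =>
    have hs := hrun.step j
    simp only [P2GPStep, ih.2] at hs
    exact ⟨hs.1.trans ih.1, hs.2⟩

theorem IsP2GPRun.exists_tendsto_f (hrun : P.IsP2GPRun θ x phase m)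
    (hc : StrictConvexOn ℝ P.feasible P.f) {xs : EuclideanSpace ℝ (Fin n)}
    (hmin : IsMinOn P.f P.feasible xs) : ∃ c, Tendsto (fun k => P.f (x k)) atTop (𝓝 c) :=
  ⟨_, tendsto_atTop_ciInf (hrun.antitone_f hc)
    ⟨P.f xs, by rintro _ ⟨k, rfl⟩; exact hmin (hrun.mem_feasible hc k)⟩⟩

/-- The squared step length is at most a constant times the decrease of `f`, which tends to zero.
The filter `atTop ⊓ 𝓟 (gpIterations phase)` expresses limits along K_GP. -/
theorem IsP2GPRun.tendsto_step_zero (hrun : P.IsP2GPRun θ x phase m)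
    (hc : StrictConvexOn ℝ P.feasible P.f) {xs : EuclideanSpace ℝ (Fin n)}
    (hmin : IsMinOn P.f P.feasible xs) :
    Tendsto (fun k => x (k + 1) - x k) (atTop ⊓ 𝓟 (gpIterations phase)) (𝓝 0) := by
  obtain ⟨c, hcv⟩ := hrun.exists_tendsto_f hc hmin
  have h1 : Tendsto (fun k => Real.sqrt (θ.γ₁ / θ.μ₁ * (P.f (x k) - P.f (x (k + 1)))))
      (atTop ⊓ 𝓟 (gpIterations phase)) (𝓝 0) := by
    have := ((hcv.sub (hcv.comp (tendsto_add_atTop_nat 1))).const_mul (θ.γ₁ / θ.μ₁)).sqrt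
    simp only [sub_self, mul_zero, Real.sqrt_zero] at this
    exact this.mono_left inf_le_left
  refine squeeze_zero_norm' ?_ h1
  rw [eventually_inf_principal]
  refine Eventually.of_forall fun k hk => Real.le_sqrt_of_sq_le ?_
  have hx := hrun.mem_feasible hc k
  rcases hrun.step_cases hc hx with ⟨-, α, hα, h⟩ | ⟨h, -⟩
  · rw [h]
    exact norm_sq_le_of_suffDecrease hc.1 hx hα
  · exact absurd hk h

/-! ### Convergence to the solution and identification of active bounds -/

section Limit

variable {xs : EuclideanSpace ℝ (Fin n)} (hrun : P.IsP2GPRun θ x phase m)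
  (hc : StrictConvexOn ℝ P.feasible P.f) (hxs : xs ∈ P.feasible)
  (hmin : IsMinOn P.f P.feasible xs)
include hrun hc hxs hmin

theorem IsP2GPRun.eq_of_phase_eq_converged (htol : θ.tol = 0) {k : ℕ}
    (hk : phase k = .converged) : x k = xs := by
  refine eq_of_projGrad_eq_zero hc hxs hmin (hrun.mem_feasible hc k) ?_
  have h := hrun.conv hk
  -- By definition of the chopped gradient, `φ + β` is the negative of the projected gradient.
  rw [Conv, htol, choppedGrad] at h
  simpa using h

theorem IsP2GPRun.tendsto_f (hinf : (gpIterations phase).Infinite) :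
    Tendsto (fun k => P.f (x k)) atTop (𝓝 (P.f xs)) := by
  obtain ⟨c, hcv⟩ := hrun.exists_tendsto_f hc hmin
  obtain ⟨R, hR⟩ := exists_norm_sub_le hc hxs hmin (P.f (x 0))
  obtain ⟨a, ha, hstep⟩ := exists_stepsize_lower_bound hc.1 θ
  obtain ⟨G, hG⟩ := (isCompact_closedBall xs R).exists_bound_of_continuousOn
    P.continuous_grad.continuousOn
  have hxR : ∀ k, ‖x k - xs‖ ≤ R := fun k =>
    hR _ (hrun.mem_feasible hc k) (hrun.antitone_f hc (Nat.zero_le k))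
  have hR0 : 0 ≤ R := (norm_nonneg _).trans (hxR 0)
  have hne : NeBot (atTop ⊓ 𝓟 (gpIterations phase)) := by
    rw [← frequently_mem_iff_neBot]
    exact Nat.frequently_atTop_iff_infinite.2 hinf
  -- Here `G` bounds the gradient and `R` the distance to `xs` along the run, and `a` bounds the
  -- step lengths below; the gap at `x k` is at most `(G + a⁻¹ * R)` times the step norm.
  have hle : c ≤ P.f xs := by
    have hlim := ((hrun.tendsto_step_zero hc hmin).norm.const_mul (G + a⁻¹ * R)).const_add
      (P.f xs)
    simp only [norm_zero, mul_zero, add_zero] at hlim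
    refine le_of_tendsto_of_tendsto (hcv.mono_left inf_le_left) hlim ?_
    rw [EventuallyLE, eventually_inf_principal]
    refine Eventually.of_forall fun k hk => ?_
    have hx := hrun.mem_feasible hc k
    rcases hrun.step_cases hc hx with ⟨-, α, hα, h⟩ | ⟨h, -⟩
    swap
    · exact absurd hk h
    have h1 := gpPoint_inner_nonneg hc.1 hx hα.pos hxs
    rw [← h, inner_add_left, inner_smul_left] at h1
    simp only [RCLike.conj_to_real] at h1
    have h2 := f_add_inner_grad_le hc hx hxs
    rw [← sub_add_sub_cancel xs (x (k + 1)) (x k), inner_add_right] at h2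
    have h3 : |inner ℝ (P.grad (x k)) (x (k + 1) - x k)| ≤ G * ‖x (k + 1) - x k‖ :=
      (abs_real_inner_le_norm _ _).trans
        (mul_le_mul_of_nonneg_right (hG _ (by simpa [dist_eq_norm] using hxR k)) (norm_nonneg _))
    have h4 : inner ℝ (x (k + 1) - x k) (xs - x (k + 1)) ≤ ‖x (k + 1) - x k‖ * R :=
      (real_inner_le_norm _ _).trans (mul_le_mul_of_nonneg_left
        (by rw [norm_sub_rev]; exact hxR (k + 1)) (norm_nonneg _))
    have hα0 := hα.pos
    have h5 : α⁻¹ * inner ℝ (x (k + 1) - x k) (xs - x (k + 1)) ≤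
        a⁻¹ * (‖x (k + 1) - x k‖ * R) :=
      (mul_le_mul_of_nonneg_left h4 (by positivity)).trans
        (mul_le_mul_of_nonneg_right (inv_anti₀ ha (hstep _ hx _ hα)) (by positivity))
    have h6 := neg_abs_le (inner ℝ (P.grad (x k)) (x (k + 1) - x k))
    show P.f (x k) ≤ P.f xs + (G + a⁻¹ * R) * ‖x (k + 1) - x k‖
    linarith
  have hge : P.f xs ≤ c := ge_of_tendsto' hcv fun k => hmin (hrun.mem_feasible hc k)
  rwa [← le_antisymm hle hge]

/-- In gradient projection iterations the coordinates with nonzero multipliers are eventually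
fixed at their values at the solution. -/
theorem IsP2GPRun.eventually_eq_of_gpIterations (hlim : Tendsto x atTop (𝓝 xs)) {ρ : ℝ}
    {lam : Fin n → ℝ} (hlam : P.IsMultiplier xs ρ lam) :
    ∀ᶠ k in atTop ⊓ 𝓟 (gpIterations phase), ∀ i, lam i ≠ 0 → x (k + 1) i = xs i := by
  obtain ⟨a, ha, hstep⟩ := exists_stepsize_lower_bound hc.1 θ
  -- Outside K_GP the value of `α` is irrelevant and is set to 0.
  have hex : ∀ k, ∃ α, k ∈ gpIterations phase →
      P.SuffDecrease θ (x k) α ∧ x (k + 1) = P.gpPoint (x k) α := by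
    intro k
    rcases hrun.step_cases hc (hrun.mem_feasible hc k) with ⟨-, α, h⟩ | ⟨h, -⟩
    · exact ⟨α, fun _ => h⟩
    · exact ⟨0, fun hk => absurd hk h⟩
  choose α hα using hex
  set w : ℕ → EuclideanSpace ℝ (Fin n) :=
    fun k => P.grad (x k) + (α k)⁻¹ • (x (k + 1) - x k) with hw
  have hwlim : Tendsto w (atTop ⊓ 𝓟 (gpIterations phase)) (𝓝 (P.grad xs)) := by
    have h1 : Tendsto (fun k => P.grad (x k)) (atTop ⊓ 𝓟 (gpIterations phase)) (𝓝 (P.grad xs)) :=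
      ((P.continuous_grad.tendsto xs).comp hlim).mono_left inf_le_left
    have h2 : Tendsto (fun k => (α k)⁻¹ • (x (k + 1) - x k)) (atTop ⊓ 𝓟 (gpIterations phase))
        (𝓝 0) := by
      have h3 := (hrun.tendsto_step_zero hc hmin).norm.const_mul a⁻¹
      rw [norm_zero, mul_zero] at h3
      refine squeeze_zero_norm' ?_ h3
      rw [eventually_inf_principal]
      refine Eventually.of_forall fun k hk => ?_
      have hαk := (hα k hk).1
      have hpos := hαk.pos
      rw [norm_smul, Real.norm_of_nonneg (by positivity)]
      exact mul_le_mul_of_nonneg_right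
        (inv_anti₀ ha (hstep _ (hrun.mem_feasible hc k) _ hαk)) (norm_nonneg _)
    simpa using h1.add h2
  have hopt : ∀ k ∈ gpIterations phase, ∀ z ∈ P.feasible, 0 ≤ inner ℝ (w k) (z - x (k + 1)) := by
    intro k hk z hz
    obtain ⟨h1, h2⟩ := hα k hk
    have := gpPoint_inner_nonneg hc.1 (hrun.mem_feasible hc k) h1.pos hz
    rwa [← h2] at this
  -- `A` runs through the finitely many pairs of active sets. A pair that recurs only finitely often
  -- is eventually harmless.
  have key : ∀ A : Set (Fin n) × Set (Fin n), ∀ᶠ k in atTop ⊓ 𝓟 (gpIterations phase),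
      (P.activeLower (x (k + 1)), P.activeUpper (x (k + 1))) = A →
        ∀ i, lam i ≠ 0 → x (k + 1) i = xs i := by
    intro A
    by_contra hcon
    rw [not_eventually] at hcon
    have hfr : ∃ᶠ k in atTop ⊓ 𝓟 (gpIterations phase),
        (P.activeLower (x (k + 1)), P.activeUpper (x (k + 1))) = A :=
      hcon.mono fun k hk => (Classical.not_imp.1 hk).1
    obtain ⟨k₀, hk₀⟩ := hcon.exists
    obtain ⟨hA, hne⟩ := Classical.not_imp.1 hk₀
    refine hne fun i hi => hlam.eq_of_inner_nonneg hxs (hrun.mem_feasible hc _) ?_ hi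
    -- The point `x (k₀ + 1)` stays fixed while `k` runs through the later visits to the same face;
    -- each `w k` is minimal at this point too, and only `w k` has to converge.
    refine ge_of_tendsto_of_frequently (hwlim.inner tendsto_const_nhds)
      ((hfr.and_eventually (eventually_inf_principal.2 (Eventually.of_forall
        fun k hk => hk))).mono fun k hk => ?_)
    obtain ⟨hkA, hk⟩ := hk
    obtain ⟨e1, e2⟩ := Prod.mk.inj (hkA.trans hA.symm)
    exact inner_sub_nonneg_of_activeSubset (hrun.mem_feasible hc _) (hrun.mem_feasible hc _)
      ⟨e1.subset, e2.subset⟩ (hopt k hk) hxs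
  filter_upwards [eventually_all.2 key] with k hk
  exact hk _ rfl

/-- A late gradient projection step makes these bounds active, later ones do so afresh, and every
other iteration preserves active bounds. -/
theorem IsP2GPRun.eventually_active (hinf : (gpIterations phase).Infinite)
    (hlim : Tendsto x atTop (𝓝 xs)) {ρ : ℝ} {lam : Fin n → ℝ} (hlam : P.IsMultiplier xs ρ lam) :
    ∀ᶠ k in atTop, {i ∈ P.activeLower xs | lam i ≠ 0} ⊆ P.activeLower (x k) ∧
      {i ∈ P.activeUpper xs | lam i ≠ 0} ⊆ P.activeUpper (x k) := by
  have h := hrun.eventually_eq_of_gpIterations hc hxs hmin hlim hlam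
  rw [eventually_inf_principal, eventually_atTop] at h
  obtain ⟨N, hN⟩ := h
  have hgp : ∀ k, N ≤ k → k ∈ gpIterations phase →
      {i ∈ P.activeLower xs | lam i ≠ 0} ⊆ P.activeLower (x (k + 1)) ∧
      {i ∈ P.activeUpper xs | lam i ≠ 0} ⊆ P.activeUpper (x (k + 1)) := by
    intro k hk hkg
    have he := hN k hk hkg
    exact ⟨fun i hi => by simpa [activeLower, he i hi.2] using hi.1,
      fun i hi => by simpa [activeUpper, he i hi.2] using hi.1⟩
  -- The induction starts at `K + 1`, the iterate produced by the first step known to identify the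
  -- bounds.
  obtain ⟨K, hK, hNK⟩ := hinf.exists_gt N
  rw [eventually_atTop]
  refine ⟨K + 1, fun k hk => ?_⟩
  induction k, hk using Nat.le_induction with
  | base => exact hgp K hNK.le hK
  | succ k hk ih =>
    rcases hrun.step_cases hc (hrun.mem_feasible hc k) with ⟨h, -⟩ | ⟨-, -, -, h⟩
    · exact hgp k (by omega) h
    · exact ⟨ih.1.trans h.1, ih.2.trans h.2⟩

end Limit

end Run

end SLBQP

theorem mainTheorem4 (n : ℕ) (P : SLBQP n)
    (hconvex : StrictConvexOn ℝ P.feasible P.f)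
    (xs : EuclideanSpace ℝ (Fin n)) (hxs : xs ∈ P.feasible) (hmin : IsMinOn P.f P.feasible xs)
    (θ : P2GPParams) (x : ℕ → EuclideanSpace ℝ (Fin n)) (phase : ℕ → P2GPPhase) (m : ℕ → ℕ)
    (hrun : P.IsP2GPRun θ x phase m)
    (hinf : (gpIterations phase).Infinite ∨ (θ.tol = 0 ∧ ∃ k, phase k = P2GPPhase.converged)) :
    Filter.Tendsto x Filter.atTop (nhds xs) ∧
    (∀ᶠ k in Filter.atTop, P.ActiveSubset (x k) xs) ∧
    ∀ (ρ : ℝ) (lam : Fin n → ℝ), P.IsMultiplier xs ρ lam →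
      ∀ᶠ k in Filter.atTop,
        {i ∈ P.activeLower xs | lam i ≠ 0} ⊆ P.activeLower (x k) ∧
        {i ∈ P.activeUpper xs | lam i ≠ 0} ⊆ P.activeUpper (x k) := by
  rcases hinf with hinf | ⟨htol, K, hK⟩
  · have hlim := SLBQP.tendsto_of_tendsto_f hconvex hxs hmin (hrun.mem_feasible hconvex)
      (hrun.tendsto_f hconvex hxs hmin hinf)
    exact ⟨hlim, SLBQP.eventually_activeSubset hlim, fun ρ lam hlam =>
      hrun.eventually_active hconvex hxs hmin hinf hlim hlam⟩
  · have hx : ∀ᶠ k in atTop, x k = xs := by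
      filter_upwards [eventually_ge_atTop K] with k hk
      rw [(hrun.eq_of_converged hK hk).1,
        hrun.eq_of_phase_eq_converged hconvex hxs hmin htol hK]
    have hlim : Tendsto x atTop (𝓝 xs) :=
      tendsto_const_nhds.congr' (hx.mono fun k hk => hk.symm)
    refine ⟨hlim, SLBQP.eventually_activeSubset hlim, fun ρ lam _ => ?_⟩
    filter_upwards [hx] with k hk
    rw [hk]
    exact ⟨fun i hi => hi.1, fun i hi => hi.1⟩
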